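/- For $\tau$ in the upper half-plane $\mathbb{H}$ put $q=e^{2\pi i\tau}$ and $E_2=1-24\sum_{n\ge1}\sigma_1(n)q^n$, $E_4=1+240\sum_{n\ge1}\sigma_3(n)q^n$, $E_6=1-504\sum_{n\ge1}\sigma_5(n)q^n$, where $\sigma_k(n)=\sum_{d\mid n}d^k$. Let $\Delta=(E_4^3-E_6^2)/1728$, let $\Delta^{1/12}$ be the holomorphic twelfth root of $\Delta$ on $\mathbb{H}$ that takes positive real values on the positive imaginary axis, and let $J=E_4^3/(E_4^3-E_6^2)$ be the absolute invariant. Put $$H_1(\tau)=\frac{\tau E_2(\tau)-\frac{6i}{\pi}}{\Delta^{1/12}(\tau)},\qquad H_2(\tau)=\frac{E_2(\tau)}{\Delta^{1/12}(\tau)}.$$ Then $H_1$ and $H_2$, considered as functions of $J$ through local branches $\tau=\tau(J)$ of the inverse of $J$ away from the values $0$ and $1$, form a fundamental system of solutions of the hypergeometric differential equation $$w''(z)+\frac{5z-2}{6z(z-1)}\,w'(z)+\frac{1}{144z(z-1)}\,w(z)=0.$$ Explicitly: every $z\in\mathbb{C}\setminus\{0,1\}$ is a value of $J$. For every $\tau_0\in\mathbb{H}$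 with $J(\tau_0)\notin\{0,1\}$ there are a domain (that is, a non-empty connected open set) $U\subseteq\mathbb{C}\setminus\{0,1\}$ containing $J(\tau_0)$ and a continuous map $t:U\to\mathbb{H}$ with $J(t(z))=z$ for all $z\in U$ and $t(J(\tau_0))=\tau_0$. Moreover, for every domain $U\subseteq\mathbb{C}\setminus\{0,1\}$ and every continuous map $t:U\to\mathbb{H}$ with $J(t(z))=z$ for all $z\in U$, the functions $H_1\circ t$ and $H_2\circ t$ are holomorphic solutions of this equation on $U$, they are linearly independent over $\mathbb{C}$, and every holomorphic solution on $U$ is a linear combination of them with constant coefficients. -/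

import Mathlib

noncomputable section

namespace PeriodODE

open UpperHalfPlane Manifold

/-- The discriminant form `Δ = (E₄³ - E₆²) / 1728` on the upper half-plane. -/
def Delta (τ : ℍ) : ℂ := (ModularForm.E₄ τ ^ 3 - ModularForm.E₆ τ ^ 2) / 1728

/-- The absolute invariant `J = E₄³ / (E₄³ - E₆²)`. -/
def J (τ : ℍ) : ℂ :=
  ModularForm.E₄ τ ^ 3 / (ModularForm.E₄ τ ^ 3 - ModularForm.E₆ τ ^ 2)

/-- `f` is the holomorphic `k`-th root of `F` on the upper half-plane that takes positive real
values on the positive imaginary axis. -/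
structure IsNormalizedRoot (k : ℕ) (F f : ℍ → ℂ) : Prop where
  mdiff : MDiff f
  pow_eq : ∀ τ, f τ ^ k = F τ
  pos : ∀ τ : ℍ, τ.re = 0 → 0 < (f τ).re ∧ (f τ).im = 0

/-- The root `Δ^{1/12}`, written as the square of the Dedekind eta function. By
`isNormalizedRoot_deltaRoot` and `IsNormalizedRoot.eq_deltaRoot` it is the unique holomorphic
twelfth root of `Δ` that is positive on the positive imaginary axis. -/
def deltaRoot (τ : ℍ) : ℂ := ModularForm.eta τ ^ 2

theorem deltaRoot_ne_zero (τ : ℍ) : deltaRoot τ ≠ 0 :=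
  pow_ne_zero _ (ModularForm.eta_ne_zero τ.2)

theorem deltaRoot_pow (τ : ℍ) : deltaRoot τ ^ 12 = Delta τ := by
  rw [Delta, ← ModularForm.discriminant_eq_E₄_cube_sub_E₆_sq, ModularForm.discriminant, deltaRoot,
    ← pow_mul]

theorem mdiff_deltaRoot : MDiff deltaRoot := by
  rw [UpperHalfPlane.mdifferentiable_iff]
  refine .congr (fun z hz ↦ (ModularForm.differentiableAt_eta_of_mem_upperHalfPlaneSet hz).pow
    2 |>.differentiableWithinAt) fun z hz ↦ ?_
  simp [deltaRoot, ofComplex_apply_of_im_pos hz]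

theorem conj_eta {τ : ℍ} (h : τ.re = 0) :
    (starRingEnd ℂ) (ModularForm.eta τ) = ModularForm.eta τ := by
  have hτ : (starRingEnd ℂ) (τ : ℂ) = -(τ : ℂ) := by
    apply Complex.ext <;> simp [h]
  have hq : ∀ r : ℝ, (starRingEnd ℂ) (Function.Periodic.qParam r (τ : ℂ)) =
      Function.Periodic.qParam r (τ : ℂ) := by
    intro r
    rw [Function.Periodic.qParam, ← Complex.exp_conj]
    congr 1
    have h2 : (starRingEnd ℂ) 2 = 2 := Complex.conj_ofNat 2
    simp [hτ, h2]
  rw [ModularForm.eta, map_mul, hq]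
  congr 1
  have hm := (ModularForm.multipliableLocallyUniformlyOn_eta.multipliable τ.2)
  rw [hm.map_tprod (starRingEnd ℂ) Complex.continuous_conj]
  refine tprod_congr fun n ↦ ?_
  simp [ModularForm.eta_q, hq]

/-- `deltaRoot` is a twelfth root of `Δ` with the required normalization. -/
theorem isNormalizedRoot_deltaRoot : IsNormalizedRoot 12 Delta deltaRoot where
  mdiff := mdiff_deltaRoot
  pow_eq := deltaRoot_pow
  pos τ h := by
    obtain ⟨r, hr⟩ := Complex.conj_eq_iff_real.mp (conj_eta h)
    have h0 : r ≠ 0 := by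
      rintro rfl
      exact ModularForm.eta_ne_zero τ.2 (by simpa using hr)
    rw [deltaRoot, hr, ← Complex.ofReal_pow]
    exact ⟨by rw [Complex.ofReal_re]; positivity, Complex.ofReal_im _⟩

/-- The normalized twelfth root of `Δ` is unique. -/
theorem IsNormalizedRoot.eq_deltaRoot {f : ℍ → ℂ} (hf : IsNormalizedRoot 12 Delta f) :
    f = deltaRoot := by
  have hc : Continuous fun τ ↦ f τ / deltaRoot τ :=
    hf.mdiff.continuous.div mdiff_deltaRoot.continuous deltaRoot_ne_zero
  have hpow : ∀ τ, (f τ / deltaRoot τ) ^ 12 = 1 := fun τ ↦ by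
    rw [div_pow, hf.pow_eq, ← deltaRoot_pow, div_self (pow_ne_zero _ (deltaRoot_ne_zero τ))]
  have hfin : (Set.range fun τ ↦ f τ / deltaRoot τ).Finite := by
    refine ((Polynomial.nthRootsFinset 12 (1 : ℂ)).finite_toSet).subset ?_
    rintro _ ⟨τ, rfl⟩
    simpa using hpow τ
  have hsub : (Set.range fun τ ↦ f τ / deltaRoot τ).Subsingleton :=
    hfin.countable.isTotallyDisconnected _ subset_rfl (isPreconnected_range hc)
  have hI : f UpperHalfPlane.I = deltaRoot UpperHalfPlane.I := by
    obtain ⟨h1, h2⟩ := hf.pos UpperHalfPlane.I (by simp)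
    obtain ⟨h3, h4⟩ := isNormalizedRoot_deltaRoot.pos UpperHalfPlane.I (by simp)
    have e1 : f UpperHalfPlane.I = ((f UpperHalfPlane.I).re : ℂ) :=
      Complex.ext (by simp) (by simp [h2])
    have e2 : deltaRoot UpperHalfPlane.I = ((deltaRoot UpperHalfPlane.I).re : ℂ) :=
      Complex.ext (by simp) (by simp [h4])
    have h := (hf.pow_eq UpperHalfPlane.I).trans (deltaRoot_pow UpperHalfPlane.I).symm
    rw [e1, e2] at h ⊢
    norm_cast at h ⊢
    exact (pow_left_inj₀ h1.le h3.le (by norm_num)).mp h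
  funext τ
  have h := hsub ⟨τ, rfl⟩ ⟨UpperHalfPlane.I, rfl⟩
  simp only [hI, div_self (deltaRoot_ne_zero _)] at h
  exact (div_eq_one_iff_eq (deltaRoot_ne_zero τ)).mp h

/-- `H₁ = (τ E₂ - 6 i / π) / Δ^{1/12}`. -/
def H₁ (τ : ℍ) : ℂ :=
  ((τ : ℂ) * EisensteinSeries.E2 τ - 6 * Complex.I / (Real.pi : ℂ)) / deltaRoot τ

/-- `H₂ = E₂ / Δ^{1/12}`. -/
def H₂ (τ : ℍ) : ℂ := EisensteinSeries.E2 τ / deltaRoot τ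

/-- `t` is a branch on `U` of the inverse of `J`, where `U` is a domain in the complex plane that
contains neither `0` nor `1`. -/
structure IsInverseBranch (U : Set ℂ) (t : ℂ → ℍ) : Prop where
  isOpen : IsOpen U
  isConnected : IsConnected U
  zero_notMem : (0 : ℂ) ∉ U
  one_notMem : (1 : ℂ) ∉ U
  continuousOn : ContinuousOn t U
  J_eq : ∀ z ∈ U, J (t z) = z

/-- `w` is a holomorphic solution of `w'' + p w' + q w = 0` on the open set `U`. -/
structure IsSolutionOn (p q : ℂ → ℂ) (U : Set ℂ) (w : ℂ → ℂ) : Prop where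
  differentiableOn : DifferentiableOn ℂ w U
  eq_zero : ∀ z ∈ U, deriv (deriv w) z + p z * deriv w z + q z * w z = 0

/-- `w₁, w₂` is a fundamental system of solutions of `w'' + p w' + q w = 0` on `U`: a basis of the
space of holomorphic solutions on `U`. -/
structure IsFundamentalSystemOn (p q : ℂ → ℂ) (U : Set ℂ) (w₁ w₂ : ℂ → ℂ) : Prop where
  left : IsSolutionOn p q U w₁
  right : IsSolutionOn p q U w₂
  independent : ∀ a b : ℂ, (∀ z ∈ U, a * w₁ z + b * w₂ z = 0) → a = 0 ∧ b = 0
  spanning : ∀ w : ℂ → ℂ, IsSolutionOn p q U w →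
    ∃ a b : ℂ, ∀ z ∈ U, w z = a * w₁ z + b * w₂ z

end PeriodODE

end

/-! With `D = (2πi)⁻¹ d/dτ`, everything follows from Ramanujan's identities for `D E₂`, `D E₄`, `D
E₆` and from `D Δ^{1/12} = E₂/12 · Δ^{1/12}`. They give `D J = -J E₆/E₄` and `D H₂ = -E₄/(12
Δ^{1/12})`. The constant `-6i/π = 12/(2πi)` is exactly what makes `D H₁ = τ D H₂`. Along a branch,
`d/dz = -(E₄/(z E₆)) D` and `E₆² z = E₄³ (z - 1)`, so the equation reduces to algebra
(`hasDerivAt_deriv_H₂`, `isSolutionOn_H₁`). The Wronskian has no zeros, hence the two solutions form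
a basis. Ramanujan's identities and the surjectivity of `J` rest on one rigidity statement,
`eq_zero_of_slash_eq`: dividing by `Δ` leaves a level one form of negative weight, which vanishes.
Local branches come from the inverse function theorem, as `D J ≠ 0` away from the values `0` and
`1`. -/

namespace PeriodODE

open UpperHalfPlane hiding I
open Complex Filter Function ModularForm EisensteinSeries Derivative
open scoped Manifold MatrixGroups Topology Real

/-! ### Limits at `i∞`. -/

section Limits

/-- A bounded holomorphic `1`-periodic function on the upper half-plane tends at `i∞` to the
value of its cusp function at `0`. -/
theorem tendsto_atImInfty_of_periodic {f : ℍ → ℂ} (hper : Periodic (f ∘ ofComplex) (1 : ℝ))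
    (hf : MDiff f) (hb : IsBoundedAtImInfty f) :
    Tendsto f atImInfty (𝓝 (cuspFunction 1 f 0)) := by
  have ha := analyticAt_cuspFunction_zero one_pos hper hf hb
  have h : (cuspFunction 1 f ∘ fun τ ↦ Periodic.qParam 1 τ : ℍ → ℂ) = f := by
    funext τ
    simpa using eq_cuspFunction τ one_ne_zero hper
  simpa [h] using ha.continuousAt.tendsto.comp (qParam_tendsto_atImInfty one_pos)

theorem tendsto_E {k : ℕ} (hk : 3 ≤ k) (hk2 : Even k) :
    Tendsto (ModularForm.E hk) atImInfty (𝓝 1) := by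
  have hp := SlashInvariantFormClass.periodic_comp_ofComplex (ModularForm.E hk)
    one_mem_strictPeriods_SL
  have h := tendsto_atImInfty_of_periodic hp (ModularFormClass.holo _)
    (ModularFormClass.bdd_at_infty (ModularForm.E hk))
  have h1 := E_qExpansion_coeff_zero hk hk2
  rw [UpperHalfPlane.qExpansion_coeff] at h1
  simp only [Nat.factorial_zero, Nat.cast_one, inv_one, iteratedDeriv_zero, one_mul] at h1
  rwa [h1] at h

theorem periodic_E2_comp_ofComplex : Periodic (E2 ∘ ofComplex) (1 : ℝ) := by
  intro w
  by_cases! hw : 0 < im w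
  · have h : 0 < im (w + (1 : ℝ)) := by simp [hw]
    simp only [comp_apply, ofComplex_apply_of_im_pos h, ofComplex_apply_of_im_pos hw,
      E2_eq_tsum_cexp]
    simp [mul_add, Complex.exp_add]
  -- Off the half-plane `ofComplex` takes one fixed default value, so periodicity is trivial there.
  · have h : im (w + (1 : ℝ)) ≤ 0 := by simpa using hw
    simp only [comp_apply, ofComplex_apply_of_im_nonpos h, ofComplex_apply_of_im_nonpos hw]

theorem tendsto_E2 : Tendsto E2 atImInfty (𝓝 1) := by
  have h := tendsto_atImInfty_of_periodic periodic_E2_comp_ofComplex E2_mdifferentiable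
    isBoundedAtImInfty_E2
  have h1 := (hasFPowerSeriesOnBall_cuspFunction one_pos
    (analyticAt_cuspFunction_zero one_pos periodic_E2_comp_ofComplex E2_mdifferentiable
      isBoundedAtImInfty_E2) (fun τ ↦ by
    simpa only [Function.Periodic.qParam, ofReal_one, div_one] using
      hasSum_qExpansion_E2 (z := τ))).coeff_zero ![]
  rw [← h1] at h
  simpa using h

/-- If a holomorphic function has a limit at `i∞`, then its derivative tends to zero. -/
theorem tendsto_normalizedDeriv {F : ℍ → ℂ} (hF : MDiff F) {c : ℂ}
    (h : Tendsto F atImInfty (𝓝 c)) : Tendsto (D F) atImInfty (𝓝 0) := by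
  rw [Metric.tendsto_nhds]
  intro ε hε
  obtain ⟨A, hA⟩ := (atImInfty_mem _).mp (Metric.tendsto_nhds.mp h ε hε)
  -- The extra `1` keeps the closed unit disc about `z` in the region where `F` is within `ε` of
  -- `c`; Cauchy's estimate on that disc bounds the derivative.
  refine (atImInfty_mem _).mpr ⟨max A 1 + 1, fun z hz ↦ ?_⟩
  have him : ∀ w ∈ Metric.closedBall (z : ℂ) 1, max A 1 ≤ w.im := fun w hw ↦ by
    have h1 := (abs_im_le_norm (w - z)).trans (mem_closedBall_iff_norm.mp hw)
    rw [sub_im, abs_le] at h1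
    have h2 : (z : ℂ).im = z.im := rfl
    linarith
  have hpos : ∀ w ∈ Metric.closedBall (z : ℂ) 1, 0 < w.im := fun w hw ↦
    zero_lt_one.trans_le ((le_max_right _ _).trans (him w hw))
  have hd : DifferentiableOn ℂ (fun w ↦ (F ∘ ofComplex) w - c) (Metric.closedBall (z : ℂ) 1) :=
    ((UpperHalfPlane.mdifferentiable_iff.mp hF).mono hpos).sub_const c
  have hle : ‖deriv (fun w ↦ (F ∘ ofComplex) w - c) z‖ ≤ ε / 1 := by
    refine norm_deriv_le_of_forall_mem_sphere_norm_le one_pos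
      (hd.diffContOnCl_ball subset_rfl) fun w hw ↦ ?_
    have hw' := Metric.sphere_subset_closedBall hw
    have : dist (F ⟨w, hpos w hw'⟩) c < ε :=
      hA ⟨w, hpos w hw'⟩ ((le_max_left _ _).trans (him w hw'))
    simpa [ofComplex_apply_of_im_pos (hpos w hw'), dist_eq_norm] using this.le
  rw [deriv_sub_const, div_one] at hle
  have hpi : ‖(2 * π * I : ℂ)⁻¹‖ < 1 := by
    rw [norm_inv]
    refine inv_lt_one_of_one_lt₀ ?_
    simp only [norm_mul, norm_ofNat, norm_real, norm_I, mul_one, Real.norm_eq_abs,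
      abs_of_pos Real.pi_pos]
    linarith [Real.pi_gt_three]
  change dist (D F z) 0 < ε
  rw [dist_zero_right, normalizedDerivOfComplex, norm_mul]
  calc _ ≤ ‖(2 * π * I : ℂ)⁻¹‖ * ε := by gcongr
    _ < 1 * ε := by gcongr
    _ = ε := one_mul ε

theorem tendsto_serreDerivative {F : ℍ → ℂ} (hF : MDiff F) (k : ℂ) {c : ℂ}
    (h : Tendsto F atImInfty (𝓝 c)) :
    Tendsto (serreDerivative k F) atImInfty (𝓝 (-(k * 12⁻¹ * c))) := by
  simpa using (tendsto_normalizedDeriv hF h).sub ((tendsto_E2.const_mul (k * 12⁻¹)).mul h)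

end Limits

/-! ### Rigidity of level one forms of weight below `12`. -/

section LevelOne

/-- A holomorphic function of weight less than `12` for the full modular group that vanishes at
`i∞` is zero. -/
theorem eq_zero_of_slash_eq {k : ℤ} (hk : k < 12) {F : ℍ → ℂ} (hF : MDiff F)
    (hs : ∀ γ : SL(2, ℤ), F ∣[k] γ = F) (h0 : Tendsto F atImInfty (𝓝 0)) : F = 0 := by
  let g : CuspForm 𝒮ℒ k :=
    { toFun := F
      slash_action_eq' := fun A hA ↦ by
        obtain ⟨A, rfl⟩ := hA
        exact hs A
      holo' := hF
      zero_at_cusps' := fun hc ↦ by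
        rw [Subgroup.IsArithmetic.isCusp_iff_isCusp_SL2Z] at hc
        rw [OnePoint.isZeroAt_iff_forall_SL2Z hc]
        intro γ _
        rw [hs γ]
        exact h0 }
  -- The quotient `g / Δ` is a level one modular form of weight `k - 12 < 0`.
  have hg := ModularFormClass.levelOne_neg_weight_eq_zero (by lia) (CuspForm.discriminantEquiv g)
  funext z
  have := discriminant_mul_discriminantEquiv_apply g z
  rw [hg, Pi.zero_apply, mul_zero] at this
  exact this.symm

theorem E_slash {k : ℕ} (hk : 3 ≤ k) (γ : SL(2, ℤ)) :
    (ModularForm.E hk : ℍ → ℂ) ∣[(k : ℤ)] γ = ModularForm.E hk :=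
  SlashInvariantForm.slash_action_eqn (ModularForm.E hk) _ (MonoidHom.mem_range.mpr ⟨γ, rfl⟩)

theorem mdiff_E {k : ℕ} (hk : 3 ≤ k) : MDiff (ModularForm.E hk : ℍ → ℂ) :=
  ModularFormClass.holo _

/-- Two holomorphic functions of the same weight less than `12` for the full modular group agree
if they have the same limit at `i∞`. -/
theorem eq_of_slash_eq {k : ℤ} (hk : k < 12) {F G : ℍ → ℂ} (hF : MDiff F) (hG : MDiff G)
    (hFs : ∀ γ : SL(2, ℤ), F ∣[k] γ = F) (hGs : ∀ γ : SL(2, ℤ), G ∣[k] γ = G) {c : ℂ}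
    (hFc : Tendsto F atImInfty (𝓝 c)) (hGc : Tendsto G atImInfty (𝓝 c)) : F = G := by
  refine sub_eq_zero.mp (eq_zero_of_slash_eq hk (hF.sub hG) (fun γ ↦ ?_) ?_)
  · rw [sub_eq_add_neg, SlashAction.add_slash, SlashAction.neg_slash, hFs, hGs]
  · simpa using! hFc.sub hGc

end LevelOne

/-! ### Ramanujan's differential equations. -/

section Ramanujan

/-- The Serre derivative raises the weight by `2`, so both sides have weight `6` and only the limits
at `i∞` need comparing: `-k/12` with `k = 4`. -/
theorem serreDerivative_E₄ : serreDerivative 4 E₄ = (-1 / 3 : ℂ) • (E₆ : ℍ → ℂ) := by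
  refine eq_of_slash_eq (k := 6) (by norm_num)
    (serreDerivative_mdifferentiable _ (mdiff_E _)) ((mdiff_E _).const_smul _) (fun γ ↦ ?_)
    (fun γ ↦ ?_) (c := -1 / 3) ?_ ?_
  · exact serreDerivative_slash_invariant (k := 4) (mdiff_E _) (E_slash _ γ)
  · rw [ModularForm.SL_smul_slash]
    congr 1
    exact E_slash (k := 6) _ γ
  · convert tendsto_serreDerivative (mdiff_E _) 4 (tendsto_E (k := 4) (by norm_num) ⟨2, rfl⟩) using 2
    norm_num
  · simpa using! (tendsto_E (k := 6) _ ⟨3, rfl⟩).const_smul (-1 / 3 : ℂ)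

theorem serreDerivative_E₆ : serreDerivative 6 E₆ = (-1 / 2 : ℂ) • (E₄ * E₄ : ℍ → ℂ) := by
  refine eq_of_slash_eq (k := 8) (by norm_num)
    (serreDerivative_mdifferentiable _ (mdiff_E _)) (((mdiff_E _).mul (mdiff_E _)).const_smul _)
    (fun γ ↦ ?_) (fun γ ↦ ?_) (c := -1 / 2) ?_ ?_
  · exact serreDerivative_slash_invariant (k := 6) (mdiff_E _) (E_slash _ γ)
  · rw [ModularForm.SL_smul_slash]
    congr 1
    rw [show (8 : ℤ) = 4 + 4 by norm_num, mul_slash_SL2]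
    congr 1 <;> exact E_slash (k := 4) _ γ
  · convert tendsto_serreDerivative (mdiff_E _) 6 (tendsto_E (k := 6) (by norm_num) ⟨3, rfl⟩) using 2
    norm_num
  · have h := tendsto_E (k := 4) (by norm_num) ⟨2, rfl⟩
    simpa using! (h.mul h).const_smul (-1 / 2 : ℂ)

theorem normalizedDeriv_denom_quotient (γ : SL(2, ℤ)) (τ : ℍ) :
    D (fun z : ℍ ↦ (γ 1 0 : ℂ) / denom γ z) τ =
      -(2 * π * I)⁻¹ * ((γ 1 0 : ℂ) / denom γ τ) ^ 2 := by
  have h := (hasDerivAt_denom_zpow (γ : GL (Fin 2) ℝ) (-1) τ).const_mul (γ 1 0 : ℂ)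
  have hev : ((fun z : ℍ ↦ (γ 1 0 : ℂ) / denom γ z) ∘ ofComplex) =ᶠ[𝓝 (τ : ℂ)]
      fun z ↦ (γ 1 0 : ℂ) * denom γ z ^ (-1 : ℤ) := by
    filter_upwards [isOpen_upperHalfPlaneSet.mem_nhds τ.im_pos] with w hw
    simp [ofComplex_apply_of_im_pos hw, div_eq_mul_inv]
  rw [normalizedDerivOfComplex, (h.congr_of_eventuallyEq hev).deriv]
  have hd := denom_ne_zero (γ : GL (Fin 2) ℝ) τ
  norm_num
  field_simp

theorem mdiff_denom_quotient (γ : SL(2, ℤ)) : MDiff (fun z : ℍ ↦ (γ 1 0 : ℂ) / denom γ z) := by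
  simpa only [div_eq_mul_inv] using!
    (mdifferentiable_inv_denom (γ : GL (Fin 2) ℝ)).const_smul (γ 1 0 : ℂ)

theorem E2_slash (γ : SL(2, ℤ)) :
    E2 ∣[(2 : ℤ)] γ = E2 + (12 * (2 * π * I)⁻¹ : ℂ) • fun z : ℍ ↦ (γ 1 0 : ℂ) / denom γ z := by
  rw [E2_slash_action]
  funext z
  have : (π : ℂ) ≠ 0 := ofReal_ne_zero.mpr Real.pi_ne_zero
  have hd := denom_ne_zero (γ : GL (Fin 2) ℝ) z
  simp only [Pi.sub_apply, Pi.add_apply, Pi.smul_apply, smul_eq_mul, D2, riemannZeta_two]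
  field_simp
  linear_combination (-12 * (γ 1 0 : ℂ)) * I_sq

/-- The index is `1` although `E₂` has weight `2`. With `r = c/(cτ+d)` and `a = 12/(2πi)`, both `D
E₂` and `E₂²/12` pick up the same anomaly `a r E₂/6 + a² r²/12`, which cancels in the difference. -/
theorem serreDerivative_E2_slash (γ : SL(2, ℤ)) :
    serreDerivative 1 E2 ∣[(4 : ℤ)] γ = serreDerivative 1 E2 := by
  have h1 : serreDerivative 1 E2 = D E2 - (12⁻¹ : ℂ) • (E2 * E2) := by
    funext z
    simp [serreDerivative]
    ring
  have h2 := normalizedDerivOfComplex_SL_slash (k := 2) E2_mdifferentiable (γ := γ)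
  rw [E2_slash, normalizedDerivOfComplex_add _ _ E2_mdifferentiable
    ((mdiff_denom_quotient γ).const_smul _), normalizedDerivOfComplex_smul _ _
    (mdiff_denom_quotient γ)] at h2
  rw [h1, sub_eq_add_neg, SlashAction.add_slash, SlashAction.neg_slash, ModularForm.SL_smul_slash]
  have h3 : (E2 * E2) ∣[(4 : ℤ)] γ = E2 ∣[(2 : ℤ)] γ * E2 ∣[(2 : ℤ)] γ :=
    mul_slash_SL2 2 2 γ E2 E2
  rw [h3, E2_slash]
  funext z
  have h4 := congrFun h2 z
  simp only [Pi.add_apply, Pi.neg_apply, Pi.sub_apply, Pi.smul_apply, Pi.mul_apply, smul_eq_mul,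
    normalizedDeriv_denom_quotient, show (2 : ℤ) + 2 = 4 by norm_num] at h4 ⊢
  push_cast at h4
  linear_combination -h4

theorem serreDerivative_E2 : serreDerivative 1 E2 = (-1 / 12 : ℂ) • (E₄ : ℍ → ℂ) := by
  refine eq_of_slash_eq (k := 4) (by norm_num)
    (serreDerivative_mdifferentiable _ E2_mdifferentiable) ((mdiff_E _).const_smul _)
    serreDerivative_E2_slash (fun γ ↦ ?_) (c := -1 / 12) ?_ ?_
  · rw [ModularForm.SL_smul_slash]
    congr 1
    exact E_slash (k := 4) _ γ
  · convert tendsto_serreDerivative E2_mdifferentiable 1 tendsto_E2 using 2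
    norm_num
  · simpa using! (tendsto_E (k := 4) _ ⟨2, rfl⟩).const_smul (-1 / 12 : ℂ)

/-- Ramanujan's identity for the derivative of `E₂`. -/
theorem normalizedDeriv_E2 (τ : ℍ) : D E2 τ = (E2 τ ^ 2 - E₄ τ) / 12 := by
  have h := congrFun serreDerivative_E2 τ
  simp only [serreDerivative_apply, Pi.smul_apply, smul_eq_mul] at h
  linear_combination h

/-- Ramanujan's identity for the derivative of `E₄`. -/
theorem normalizedDeriv_E₄ (τ : ℍ) : D E₄ τ = (E2 τ * E₄ τ - E₆ τ) / 3 := by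
  have h := congrFun serreDerivative_E₄ τ
  simp only [serreDerivative_apply, Pi.smul_apply, smul_eq_mul] at h
  linear_combination h

/-- Ramanujan's identity for the derivative of `E₆`. -/
theorem normalizedDeriv_E₆ (τ : ℍ) : D E₆ τ = (E2 τ * E₆ τ - E₄ τ ^ 2) / 2 := by
  have h := congrFun serreDerivative_E₆ τ
  simp only [serreDerivative_apply, Pi.smul_apply, Pi.mul_apply, smul_eq_mul] at h
  linear_combination h

end Ramanujan

/-! ### Derivatives of `Δ^{1/12}`, `J`, `H₁` and `H₂`. -/

section Derivatives

theorem hasDerivAt_comp_ofComplex {F : ℍ → ℂ} (hF : MDiff F) (τ : ℍ) :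
    HasDerivAt (F ∘ ofComplex) (2 * π * I * D F τ) τ := by
  have h := (UpperHalfPlane.mdifferentiableAt_iff.mp (hF τ)).hasDerivAt
  rwa [normalizedDerivOfComplex, mul_inv_cancel_left₀ two_pi_I_ne_zero]

theorem normalizedDeriv_coe (τ : ℍ) : D ((↑) : ℍ → ℂ) τ = (2 * π * I)⁻¹ := by
  have h : (((↑) : ℍ → ℂ) ∘ ofComplex) =ᶠ[𝓝 (τ : ℂ)] id := by
    filter_upwards [isOpen_upperHalfPlaneSet.mem_nhds τ.im_pos] with w hw
    simp [ofComplex_apply_of_im_pos hw]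
  rw [normalizedDerivOfComplex, h.deriv_eq, deriv_id, mul_one]

theorem normalizedDeriv_deltaRoot (τ : ℍ) : D deltaRoot τ = E2 τ / 12 * deltaRoot τ := by
  have h : (deltaRoot ∘ ofComplex) =ᶠ[𝓝 (τ : ℂ)] fun z ↦ ModularForm.eta z ^ 2 := by
    filter_upwards [isOpen_upperHalfPlaneSet.mem_nhds τ.im_pos] with w hw
    simp [deltaRoot, ofComplex_apply_of_im_pos hw]
  have h1 := logDeriv_eta_eq_E2 τ
  have h0 := eta_ne_zero τ.2
  rw [logDeriv_apply, div_eq_iff h0] at h1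
  rw [normalizedDerivOfComplex, h.deriv_eq,
    deriv_fun_pow (differentiableAt_eta_of_mem_upperHalfPlaneSet τ.2), h1, deltaRoot]
  have := two_pi_I_ne_zero
  field_simp
  ring

theorem E₄_cube_sub_E₆_sq_eq (τ : ℍ) : E₄ τ ^ 3 - E₆ τ ^ 2 = 1728 * deltaRoot τ ^ 12 := by
  rw [deltaRoot_pow, Delta]
  ring

theorem E₄_cube_sub_E₆_sq_ne_zero (τ : ℍ) : E₄ τ ^ 3 - E₆ τ ^ 2 ≠ 0 := by
  rw [E₄_cube_sub_E₆_sq_eq]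
  exact mul_ne_zero (by norm_num) (pow_ne_zero _ (deltaRoot_ne_zero τ))

theorem E₄_ne_zero_of_J_ne_zero {τ : ℍ} (h : J τ ≠ 0) : E₄ τ ≠ 0 := fun h0 ↦
  h (by simp [J, h0])

theorem E₆_ne_zero_of_J_ne_one {τ : ℍ} (h : J τ ≠ 1) : E₆ τ ≠ 0 := fun h0 ↦
  h (div_eq_one_iff_eq (E₄_cube_sub_E₆_sq_ne_zero τ) |>.mpr (by simp [h0]))

theorem mdiff_E₄ : MDiff (E₄ : ℍ → ℂ) := mdiff_E _

theorem mdiff_E₆ : MDiff (E₆ : ℍ → ℂ) := mdiff_E _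

theorem mdiff_J : MDiff J := by
  have h : MDiff ((E₄ : ℍ → ℂ) ^ 3 / ((E₄ : ℍ → ℂ) ^ 3 - (E₆ : ℍ → ℂ) ^ 2)) :=
    (mdiff_E₄.pow 3).div ((mdiff_E₄.pow 3).sub (mdiff_E₆.pow 2))
      E₄_cube_sub_E₆_sq_ne_zero
  exact h

theorem mdiff_H₂ : MDiff H₂ :=
  E2_mdifferentiable.div mdiff_deltaRoot deltaRoot_ne_zero

theorem mdiff_H₁ : MDiff H₁ :=
  ((mdifferentiable_coe.mul E2_mdifferentiable).sub mdifferentiable_const).div mdiff_deltaRoot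
    deltaRoot_ne_zero

/-- Differentiate `1728 Δ J = E₄³`: the `E₂` terms cancel. Keeping the factor `E₄` avoids dividing
at its zeros. -/
theorem E₄_mul_normalizedDeriv_J (τ : ℍ) : E₄ τ * D J τ = -(J τ * E₆ τ) := by
  have h : (deltaRoot ^ 12) * J = (1728⁻¹ : ℂ) • (E₄ : ℍ → ℂ) ^ 3 := by
    funext τ
    have := E₄_cube_sub_E₆_sq_ne_zero τ
    have h1 := E₄_cube_sub_E₆_sq_eq τ
    simp only [Pi.mul_apply, Pi.pow_apply, Pi.smul_apply, smul_eq_mul, J]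
    rw [mul_div_assoc', div_eq_iff this, h1]
    ring
  have h1 := congrFun h τ
  have h2 := congrFun (congrArg (fun F ↦ D F) h) τ
  simp only [normalizedDerivOfComplex_mul _ _ (mdiff_deltaRoot.pow 12) mdiff_J,
    normalizedDerivOfComplex_pow _ 12 mdiff_deltaRoot,
    normalizedDerivOfComplex_smul _ _ (mdiff_E₄.pow 3),
    normalizedDerivOfComplex_pow _ 3 mdiff_E₄, Pi.add_apply, Pi.mul_apply,
    Pi.pow_apply, Pi.smul_apply, smul_eq_mul, normalizedDeriv_deltaRoot, normalizedDeriv_E₄,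
    Pi.natCast_apply] at h1 h2
  push_cast at h2
  refine mul_left_cancel₀ (pow_ne_zero 12 (deltaRoot_ne_zero τ)) ?_
  linear_combination E₄ τ * h2 - (E2 τ * E₄ τ - E₆ τ) * h1

theorem normalizedDeriv_H₂ (τ : ℍ) : D H₂ τ = -E₄ τ / (12 * deltaRoot τ) := by
  have h : deltaRoot * H₂ = E2 := by
    funext τ
    exact mul_div_cancel₀ _ (deltaRoot_ne_zero τ)
  have h1 := congrFun h τ
  have h2 := congrFun (congrArg (fun F ↦ D F) h) τ
  simp only [normalizedDerivOfComplex_mul _ _ mdiff_deltaRoot mdiff_H₂, Pi.add_apply, Pi.mul_apply,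
    normalizedDeriv_deltaRoot, normalizedDeriv_E2] at h1 h2
  rw [eq_div_iff (mul_ne_zero (by norm_num) (deltaRoot_ne_zero τ))]
  linear_combination 12 * h2 - E2 τ * h1

theorem normalizedDeriv_H₁ (τ : ℍ) : D H₁ τ = -τ * E₄ τ / (12 * deltaRoot τ) := by
  have h : deltaRoot * H₁ = ((↑) : ℍ → ℂ) * E2 - fun _ ↦ 6 * I / (π : ℂ) := by
    funext τ
    exact mul_div_cancel₀ _ (deltaRoot_ne_zero τ)
  have h1 := congrFun h τ
  have h2 := congrFun (congrArg (fun F ↦ D F) h) τ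
  simp only [normalizedDerivOfComplex_mul _ _ mdiff_deltaRoot mdiff_H₁,
    normalizedDerivOfComplex_sub _ _ (mdifferentiable_coe.mul E2_mdifferentiable)
      mdifferentiable_const, normalizedDerivOfComplex_const,
    normalizedDerivOfComplex_mul _ _ mdifferentiable_coe E2_mdifferentiable,
    normalizedDeriv_coe, Pi.add_apply, Pi.mul_apply, Pi.sub_apply, Pi.zero_apply,
    normalizedDeriv_deltaRoot, normalizedDeriv_E2] at h1 h2
  -- The term `E₂/(2πi)` from `D τ` cancels against `-(E₂/12)(-6i/π)` from the denominator.
  have h3 : (2 * π * I : ℂ)⁻¹ = -(6 * I / π) / 12 := by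
    have : (π : ℂ) ≠ 0 := ofReal_ne_zero.mpr Real.pi_ne_zero
    field_simp
    linear_combination 12 * I_sq
  rw [h3] at h2
  rw [eq_div_iff (mul_ne_zero (by norm_num) (deltaRoot_ne_zero τ))]
  linear_combination 12 * h2 - E2 τ * h1

theorem normalizedDeriv_J {τ : ℍ} (h : J τ ≠ 0) : D J τ = -(J τ * E₆ τ) / E₄ τ := by
  rw [eq_div_iff (E₄_ne_zero_of_J_ne_zero h), mul_comm, E₄_mul_normalizedDeriv_J]

theorem normalizedDeriv_J_ne_zero {τ : ℍ} (h0 : J τ ≠ 0) (h1 : J τ ≠ 1) : D J τ ≠ 0 := by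
  rw [normalizedDeriv_J h0]
  exact div_ne_zero (neg_ne_zero.mpr (mul_ne_zero h0 (E₆_ne_zero_of_J_ne_one h1)))
    (E₄_ne_zero_of_J_ne_zero h0)

end Derivatives

/-! ### Surjectivity of `J` and its inverse branches. -/

section Inverse

/-- The absolute invariant takes every complex value. -/
theorem exists_J_eq (z : ℂ) : ∃ τ : ℍ, J τ = z := by
  by_contra! hz
  -- If `J` omits `z`, this weight `12` form has no zeros. Then `Δ / f` is holomorphic of weight `0`
  -- and tends to `0` at `i∞`, so it vanishes, contradicting `Δ ≠ 0`.
  let f : ℍ → ℂ := (E₄ : ℍ → ℂ) ^ 3 - (z * 1728) • discriminant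
  have hE (τ : ℍ) : 1728 * discriminant τ = E₄ τ ^ 3 - E₆ τ ^ 2 := by
    rw [discriminant_eq_E₄_cube_sub_E₆_sq]
    ring
  have hf0 (τ : ℍ) : f τ ≠ 0 := fun h ↦ hz τ <| by
    rw [J, div_eq_iff (E₄_cube_sub_E₆_sq_ne_zero τ), ← hE, ← sub_eq_zero, ← h]
    simp only [f, Pi.sub_apply, Pi.smul_apply, Pi.pow_apply, smul_eq_mul]
    ring
  have hΔ : MDiff discriminant := CuspForm.discriminant.holo'
  have hΔs (γ : SL(2, ℤ)) : discriminant ∣[(12 : ℤ)] γ = discriminant :=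
    SlashInvariantForm.slash_action_eqn CuspForm.discriminant _ (MonoidHom.mem_range.mpr ⟨γ, rfl⟩)
  have hfs (γ : SL(2, ℤ)) : f ∣[(12 : ℤ)] γ = f := by
    have h4 : (E₄ : ℍ → ℂ) ∣[(4 : ℤ)] γ = E₄ := E_slash (k := 4) _ γ
    have h : ((E₄ : ℍ → ℂ) ^ 3) ∣[(12 : ℤ)] γ = (E₄ : ℍ → ℂ) ^ 3 := by
      rw [pow_succ, pow_two, show (12 : ℤ) = 4 + 4 + 4 by norm_num, mul_slash_SL2, mul_slash_SL2,
        h4]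
    simp only [f]
    rw [sub_eq_add_neg, SlashAction.add_slash, SlashAction.neg_slash, ModularForm.SL_smul_slash,
      h, hΔs]
  have hΔ0 : Tendsto discriminant atImInfty (𝓝 0) := discriminant_isZeroAtImInfty
  have hf1 : Tendsto f atImInfty (𝓝 1) := by
    have h4 : Tendsto (E₄ : ℍ → ℂ) atImInfty (𝓝 1) := tendsto_E (k := 4) _ ⟨2, rfl⟩
    have h := (h4.pow 3).sub (hΔ0.const_smul (z * 1728))
    rwa [one_pow, smul_zero, sub_zero] at h
  have hf : MDiff f := (mdiff_E₄.pow 3).sub (hΔ.const_smul (z * 1728))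
  have h := eq_zero_of_slash_eq (k := 0) (by norm_num) (hΔ.div hf hf0)
    (fun γ ↦ by rw [show (0 : ℤ) = 12 - 12 by norm_num, div_slash_SL2, hΔs, hfs])
    (by rw [← zero_div (1 : ℂ)]; exact hΔ0.div hf1 one_ne_zero)
  exact div_ne_zero (discriminant_ne_zero UpperHalfPlane.I) (hf0 _)
    (congrFun h UpperHalfPlane.I)

/-- Away from the values `0` and `1`, the absolute invariant has local inverses. -/
theorem exists_isInverseBranch {τ : ℍ} (h0 : J τ ≠ 0) (h1 : J τ ≠ 1) :
    ∃ (U : Set ℂ) (t : ℂ → ℍ), IsInverseBranch U t ∧ J τ ∈ U ∧ t (J τ) = τ := by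
  have hd : HasStrictDerivAt (J ∘ ofComplex) (2 * π * I * D J τ) τ := by
    have ha : AnalyticAt ℂ (J ∘ ofComplex) τ :=
      (UpperHalfPlane.mdifferentiable_iff.mp mdiff_J).analyticAt
        (isOpen_upperHalfPlaneSet.mem_nhds τ.im_pos)
    have := ha.hasStrictDerivAt
    rwa [(hasDerivAt_comp_ofComplex mdiff_J τ).deriv] at this
  have hne := mul_ne_zero two_pi_I_ne_zero (normalizedDeriv_J_ne_zero h0 h1)
  let e := (hd.hasStrictFDerivAt_equiv hne).toOpenPartialHomeomorph
  have heτ : e τ = J τ := by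
    change (J ∘ ofComplex) τ = J τ
    simp
  have hτs : (τ : ℂ) ∈ e.source :=
    (hd.hasStrictFDerivAt_equiv hne).mem_toOpenPartialHomeomorph_source
  have hsymm : e.symm (J τ) = τ := by rw [← heτ, e.left_inv hτs]
  have hV : IsOpen (e.target ∩ e.symm ⁻¹' {z | 0 < z.im}) :=
    e.symm.isOpen_inter_preimage isOpen_upperHalfPlaneSet
  have hmem : J τ ∈ (e.target ∩ e.symm ⁻¹' {z | 0 < z.im}) ∩ ({0, 1} : Set ℂ)ᶜ :=
    ⟨⟨heτ ▸ e.map_source hτs, by simpa [hsymm] using τ.im_pos⟩, by simp [h0, h1]⟩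
  obtain ⟨r, hr, hball⟩ := Metric.isOpen_iff.mp
    (hV.inter (Set.toFinite ({0, 1} : Set ℂ)).isClosed.isOpen_compl) _ hmem
  -- A ball is used to make the domain connected.
  refine ⟨Metric.ball (J τ) r, fun z ↦ ofComplex (e.symm z), ⟨Metric.isOpen_ball,
    ⟨⟨_, Metric.mem_ball_self hr⟩, (convex_ball _ _).isPreconnected⟩,
    fun h ↦ (hball h).2 (by simp), fun h ↦ (hball h).2 (by simp), fun z hz ↦ ?_, fun z hz ↦ ?_⟩,
    Metric.mem_ball_self hr, by simp [hsymm]⟩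
  · have hz' := (hball hz).1
    exact ((contMDiffAt_ofComplex (n := 0) hz'.2).continuousAt.comp
      (e.symm.continuousAt hz'.1)).continuousWithinAt
  · exact e.right_inv (hball hz).1.1

variable {U : Set ℂ} {t : ℂ → ℍ}

namespace IsInverseBranch

theorem ne_zero (ht : IsInverseBranch U t) {z : ℂ} (hz : z ∈ U) : z ≠ 0 :=
  ne_of_mem_of_not_mem hz ht.zero_notMem

theorem ne_one (ht : IsInverseBranch U t) {z : ℂ} (hz : z ∈ U) : z ≠ 1 :=
  ne_of_mem_of_not_mem hz ht.one_notMem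

theorem E₄_ne_zero (ht : IsInverseBranch U t) {z : ℂ} (hz : z ∈ U) : E₄ (t z) ≠ 0 :=
  E₄_ne_zero_of_J_ne_zero (by rw [ht.J_eq z hz]; exact ht.ne_zero hz)

theorem E₆_ne_zero (ht : IsInverseBranch U t) {z : ℂ} (hz : z ∈ U) : E₆ (t z) ≠ 0 :=
  E₆_ne_zero_of_J_ne_one (by rw [ht.J_eq z hz]; exact ht.ne_one hz)

/-- A continuous right inverse of `J` is automatically holomorphic where `J' ≠ 0`. -/
theorem hasDerivAt_coe (ht : IsInverseBranch U t) {z : ℂ} (hz : z ∈ U) :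
    HasDerivAt (fun z ↦ (t z : ℂ)) (2 * π * I * D J (t z))⁻¹ z := by
  have hJ := ht.J_eq z hz
  refine HasDerivAt.of_local_left_inverse (f := J ∘ ofComplex) ?_
    (hasDerivAt_comp_ofComplex mdiff_J (t z)) (mul_ne_zero two_pi_I_ne_zero
      (normalizedDeriv_J_ne_zero (by rw [hJ]; exact ht.ne_zero hz) (by rw [hJ]; exact ht.ne_one hz))) ?_
  · exact UpperHalfPlane.continuous_coe.continuousAt.comp
      (ht.continuousOn.continuousAt (ht.isOpen.mem_nhds hz))
  · filter_upwards [ht.isOpen.mem_nhds hz] with y hy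
    simpa using ht.J_eq y hy

/-- The chain rule along an inverse branch of `J`. -/
theorem hasDerivAt_comp (ht : IsInverseBranch U t) {F : ℍ → ℂ} (hF : MDiff F) {z : ℂ}
    (hz : z ∈ U) :
    HasDerivAt (fun z ↦ F (t z)) (-(E₄ (t z) / (z * E₆ (t z))) * D F (t z)) z := by
  have hJ := ht.J_eq z hz
  have h := (hasDerivAt_comp_ofComplex hF (t z)).comp z (ht.hasDerivAt_coe hz)
  have h4 := ht.E₄_ne_zero hz
  have h6 := ht.E₆_ne_zero hz
  have h0 := ht.ne_zero hz
  have hpi := two_pi_I_ne_zero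
  convert! h using 1
  · funext y
    simp
  · rw [normalizedDeriv_J (by rwa [hJ]), hJ]
    field_simp

end IsInverseBranch

end Inverse

/-! ### Wronskians and fundamental systems. -/

section LinearODE

variable {p q : ℂ → ℂ} {U : Set ℂ} {w₁ w₂ : ℂ → ℂ}

namespace IsSolutionOn

theorem hasDerivAt (h : IsSolutionOn p q U w₁) (hU : IsOpen U) {z : ℂ} (hz : z ∈ U) :
    HasDerivAt w₁ (deriv w₁ z) z :=
  (h.differentiableOn.differentiableAt (hU.mem_nhds hz)).hasDerivAt

theorem hasDerivAt_deriv (h : IsSolutionOn p q U w₁) (hU : IsOpen U) {z : ℂ} (hz : z ∈ U) :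
    HasDerivAt (deriv w₁) (-(p z * deriv w₁ z + q z * w₁ z)) z := by
  have h1 := ((h.differentiableOn.deriv hU).differentiableAt (hU.mem_nhds hz)).hasDerivAt
  rwa [show deriv (deriv w₁) z = -(p z * deriv w₁ z + q z * w₁ z) by
    linear_combination h.eq_zero z hz] at h1

/-- Abel's identity for the Wronskian of two solutions. -/
theorem hasDerivAt_wronskian (h₁ : IsSolutionOn p q U w₁) (h₂ : IsSolutionOn p q U w₂)
    (hU : IsOpen U) {z : ℂ} (hz : z ∈ U) :
    HasDerivAt (fun z ↦ w₁ z * deriv w₂ z - deriv w₁ z * w₂ z)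
      (-p z * (w₁ z * deriv w₂ z - deriv w₁ z * w₂ z)) z := by
  refine (((h₁.hasDerivAt hU hz).mul (h₂.hasDerivAt_deriv hU hz)).sub
    ((h₁.hasDerivAt_deriv hU hz).mul (h₂.hasDerivAt hU hz))).congr_deriv ?_
  ring

end IsSolutionOn

/-- Two solutions on a domain whose Wronskian has no zeros form a fundamental system. -/
theorem isFundamentalSystemOn_of_wronskian_ne_zero (hU : IsOpen U) (hc : IsConnected U)
    (h₁ : IsSolutionOn p q U w₁) (h₂ : IsSolutionOn p q U w₂)
    (hW : ∀ z ∈ U, w₁ z * deriv w₂ z - deriv w₁ z * w₂ z ≠ 0) :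
    IsFundamentalSystemOn p q U w₁ w₂ := by
  -- All Wronskians satisfy `W' = -p W`, so their ratios are constant on a domain. These constants
  -- are the coefficients in Cramer's rule for `w`.
  have hconst {f g : ℂ → ℂ} (hf : IsSolutionOn p q U f) (hg : IsSolutionOn p q U g) :
      ∃ a, ∀ z ∈ U, (f z * deriv g z - deriv f z * g z) /
        (w₁ z * deriv w₂ z - deriv w₁ z * w₂ z) = a := by
    have hd (z : ℂ) (hz : z ∈ U) := ((hf.hasDerivAt_wronskian hg hU hz).fun_div
      (h₁.hasDerivAt_wronskian h₂ hU hz) (hW z hz))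
    refine hU.exists_is_const_of_deriv_eq_zero hc.isPreconnected
      (fun z hz ↦ (hd z hz).differentiableAt.differentiableWithinAt) fun z hz ↦ ?_
    rw [(hd z hz).deriv, Pi.zero_apply, div_eq_zero_iff]
    left
    ring
  refine ⟨h₁, h₂, fun a b hab ↦ ?_, fun w hw ↦ ?_⟩
  · obtain ⟨z, hz⟩ := hc.nonempty
    have h0 := hab z hz
    have hd : a * deriv w₁ z + b * deriv w₂ z = 0 := by
      have h := ((h₁.hasDerivAt hU hz).const_mul a).add ((h₂.hasDerivAt hU hz).const_mul b)
      refine h.unique ((hasDerivAt_const z (0 : ℂ)).congr_of_eventuallyEq ?_)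
      filter_upwards [hU.mem_nhds hz] with y hy using hab y hy
    refine ⟨(mul_eq_zero.mp ?_).resolve_right (hW z hz),
      (mul_eq_zero.mp ?_).resolve_right (hW z hz)⟩
    · linear_combination deriv w₂ z * h0 - w₂ z * hd
    · linear_combination w₁ z * hd - deriv w₁ z * h0
  · obtain ⟨a, ha⟩ := hconst hw h₂
    obtain ⟨b, hb⟩ := hconst h₁ hw
    refine ⟨a, b, fun z hz ↦ ?_⟩
    have h := hW z hz
    rw [← ha z hz, ← hb z hz]
    rw [div_mul_eq_mul_div, div_mul_eq_mul_div, ← add_div, eq_div_iff h]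
    ring

end LinearODE

/-! ### The hypergeometric equation along a branch. -/

section Hypergeometric

variable {U : Set ℂ} {t : ℂ → ℍ}

namespace IsInverseBranch

theorem E₆_sq_mul (ht : IsInverseBranch U t) {z : ℂ} (hz : z ∈ U) :
    E₆ (t z) ^ 2 * z = E₄ (t z) ^ 3 * (z - 1) := by
  have h := ht.J_eq z hz
  rw [J, div_eq_iff (E₄_cube_sub_E₆_sq_ne_zero _)] at h
  linear_combination h

theorem hasDerivAt_H₂ (ht : IsInverseBranch U t) {z : ℂ} (hz : z ∈ U) :
    HasDerivAt (fun z ↦ H₂ (t z))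
      (E₄ (t z) ^ 2 / (12 * deltaRoot (t z) * (z * E₆ (t z)))) z := by
  refine (ht.hasDerivAt_comp mdiff_H₂ hz).congr_deriv ?_
  have := ht.ne_zero hz
  have := ht.E₆_ne_zero hz
  have := deltaRoot_ne_zero (t z)
  rw [normalizedDeriv_H₂]
  field_simp

theorem hasDerivAt_H₁ (ht : IsInverseBranch U t) {z : ℂ} (hz : z ∈ U) :
    HasDerivAt (fun z ↦ H₁ (t z))
      (t z * (E₄ (t z) ^ 2 / (12 * deltaRoot (t z) * (z * E₆ (t z))))) z := by
  refine (ht.hasDerivAt_comp mdiff_H₁ hz).congr_deriv ?_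
  have := ht.ne_zero hz
  have := ht.E₆_ne_zero hz
  have := deltaRoot_ne_zero (t z)
  rw [normalizedDeriv_H₁]
  field_simp

/-- Take the logarithmic derivative. The `E₂` coefficients `2/3 - 1/12 - 1/2 = 1/12` yield the `H₂`
term; the rest is `2/(3z) - 1/z - 1/(2(z - 1)) = -(5z - 2)/(6z(z - 1))`, using `E₄³/(z E₆²) = 1/(z -
1)`. -/
theorem hasDerivAt_deriv_H₂ (ht : IsInverseBranch U t) {z : ℂ} (hz : z ∈ U) :
    HasDerivAt (fun z ↦ E₄ (t z) ^ 2 / (12 * deltaRoot (t z) * (z * E₆ (t z))))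
      (-((5 * z - 2) / (6 * z * (z - 1)) *
          (E₄ (t z) ^ 2 / (12 * deltaRoot (t z) * (z * E₆ (t z)))) +
        1 / (144 * z * (z - 1)) * H₂ (t z))) z := by
  have h0 := ht.ne_zero hz
  have h1 := sub_ne_zero.mpr (ht.ne_one hz)
  have h4 := ht.E₄_ne_zero hz
  have h6 := ht.E₆_ne_zero hz
  have hδ := deltaRoot_ne_zero (t z)
  refine (((ht.hasDerivAt_comp mdiff_E₄ hz).fun_pow 2).fun_div
    (((ht.hasDerivAt_comp mdiff_deltaRoot hz).const_mul 12).mul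
      ((hasDerivAt_id z).mul (ht.hasDerivAt_comp mdiff_E₆ hz))) (by simp [h0, h6, hδ])).congr_deriv
    ?_
  have hJ := ht.E₆_sq_mul hz
  simp only [id, Pi.mul_apply, normalizedDeriv_E₄, normalizedDeriv_deltaRoot, normalizedDeriv_E₆, H₂]
  generalize (E₄ (t z) : ℂ) = A at *
  generalize (E₆ (t z) : ℂ) = B at *
  generalize (deltaRoot (t z) : ℂ) = d at *
  generalize (E2 (t z) : ℂ) = P at *
  field_simp
  push_cast
  linear_combination (5184 * B * P + 31104 * A ^ 2) * hJ

theorem isSolutionOn_H₂ (ht : IsInverseBranch U t) :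
    IsSolutionOn (fun z ↦ (5 * z - 2) / (6 * z * (z - 1))) (fun z ↦ 1 / (144 * z * (z - 1))) U
      (fun z ↦ H₂ (t z)) where
  differentiableOn z hz := (ht.hasDerivAt_H₂ hz).differentiableAt.differentiableWithinAt
  eq_zero z hz := by
    have h : deriv (fun z ↦ H₂ (t z)) =ᶠ[𝓝 z]
        fun z ↦ E₄ (t z) ^ 2 / (12 * deltaRoot (t z) * (z * E₆ (t z))) := by
      filter_upwards [ht.isOpen.mem_nhds hz] with y hy using (ht.hasDerivAt_H₂ hy).deriv
    rw [h.deriv_eq, (ht.hasDerivAt_deriv_H₂ hz).deriv, (ht.hasDerivAt_H₂ hz).deriv]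
    ring

/-- Since `H₁' = t H₂'`, the equation for `H₂` reduces the claim to `t' H₂' + q (H₁ - t H₂) = 0`,
where `H₁ - t H₂ = -6i/(π Δ^{1/12})`. -/
theorem isSolutionOn_H₁ (ht : IsInverseBranch U t) :
    IsSolutionOn (fun z ↦ (5 * z - 2) / (6 * z * (z - 1))) (fun z ↦ 1 / (144 * z * (z - 1))) U
      (fun z ↦ H₁ (t z)) where
  differentiableOn z hz := (ht.hasDerivAt_H₁ hz).differentiableAt.differentiableWithinAt
  eq_zero z hz := by
    have h : deriv (fun z ↦ H₁ (t z)) =ᶠ[𝓝 z]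
        fun z ↦ t z * (E₄ (t z) ^ 2 / (12 * deltaRoot (t z) * (z * E₆ (t z)))) := by
      filter_upwards [ht.isOpen.mem_nhds hz] with y hy using (ht.hasDerivAt_H₁ hy).deriv
    have h0 := ht.ne_zero hz
    have h1 := sub_ne_zero.mpr (ht.ne_one hz)
    have h4 := ht.E₄_ne_zero hz
    have h6 := ht.E₆_ne_zero hz
    have hδ := deltaRoot_ne_zero (t z)
    have hJ := ht.E₆_sq_mul hz
    have hπ : (π : ℂ) ≠ 0 := ofReal_ne_zero.mpr Real.pi_ne_zero
    rw [h.deriv_eq, ((ht.hasDerivAt_coe hz).fun_mul (ht.hasDerivAt_deriv_H₂ hz)).deriv,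
      (ht.hasDerivAt_H₁ hz).deriv, normalizedDeriv_J (by rwa [ht.J_eq z hz]), ht.J_eq z hz, H₁, H₂]
    generalize (E₄ (t z) : ℂ) = A at *
    generalize (E₆ (t z) : ℂ) = B at *
    generalize (deltaRoot (t z) : ℂ) = d at *
    generalize (E2 (t z) : ℂ) = P at *
    field_simp
    linear_combination 864 * hJ - 864 * z * B ^ 2 * I_sq

theorem isFundamentalSystemOn (ht : IsInverseBranch U t) :
    IsFundamentalSystemOn (fun z ↦ (5 * z - 2) / (6 * z * (z - 1)))
      (fun z ↦ 1 / (144 * z * (z - 1))) U (fun z ↦ H₁ (t z)) (fun z ↦ H₂ (t z)) := by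
  refine isFundamentalSystemOn_of_wronskian_ne_zero ht.isOpen ht.isConnected ht.isSolutionOn_H₁
    ht.isSolutionOn_H₂ fun z hz ↦ ?_
  have h0 := ht.ne_zero hz
  have h4 := ht.E₄_ne_zero hz
  have h6 := ht.E₆_ne_zero hz
  have hδ := deltaRoot_ne_zero (t z)
  have hπ : (π : ℂ) ≠ 0 := ofReal_ne_zero.mpr Real.pi_ne_zero
  -- The Wronskian is `(H₁ - t H₂) H₂'`, so `E₂` drops out.
  have hW : H₁ (t z) * (E₄ (t z) ^ 2 / (12 * deltaRoot (t z) * (z * E₆ (t z)))) -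
      t z * (E₄ (t z) ^ 2 / (12 * deltaRoot (t z) * (z * E₆ (t z)))) * H₂ (t z) =
      -(I * E₄ (t z) ^ 2) / (2 * π * deltaRoot (t z) ^ 2 * (z * E₆ (t z))) := by
    rw [H₁, H₂]
    field_simp
    ring
  rw [(ht.hasDerivAt_H₁ hz).deriv, (ht.hasDerivAt_H₂ hz).deriv, hW]
  simp [h0, h4, h6, hδ, hπ]

end IsInverseBranch

end Hypergeometric

end PeriodODE

/-- Away from the values `0` and `1`, inverse branches of `J` exist (near every point, and through
every preimage of it), and along every inverse branch `t` of `J` on a domain `U`, the functions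
`H₁ ∘ t` and `H₂ ∘ t` are a fundamental system of solutions on `U` of the hypergeometric equation. -/
theorem proposition9 :
    (∀ z : ℂ, z ≠ 0 → z ≠ 1 → ∃ τ : UpperHalfPlane, PeriodODE.J τ = z) ∧
    (∀ τ : UpperHalfPlane, PeriodODE.J τ ≠ 0 → PeriodODE.J τ ≠ 1 →
      ∃ (U : Set ℂ) (t : ℂ → UpperHalfPlane), PeriodODE.IsInverseBranch U t ∧
        PeriodODE.J τ ∈ U ∧ t (PeriodODE.J τ) = τ) ∧
    (∀ (U : Set ℂ) (t : ℂ → UpperHalfPlane), PeriodODE.IsInverseBranch U t →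
      PeriodODE.IsFundamentalSystemOn
        (fun z ↦ (5 * z - 2) / (6 * z * (z - 1)))
        (fun z ↦ 1 / (144 * z * (z - 1)))
        U
        (fun z ↦ PeriodODE.H₁ (t z))
        (fun z ↦ PeriodODE.H₂ (t z))) := by
  exact ⟨fun z _ _ ↦ PeriodODE.exists_J_eq z,
    fun _ h0 h1 ↦ PeriodODE.exists_isInverseBranch h0 h1,
    fun _ _ ht ↦ ht.isFundamentalSystemOn⟩
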